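/- Setting. Let $\Omega\subset\mathbb R^d$ be a bounded domain and let $X$, $Y$ be real Hilbert spaces, $Y$ continuously (and injectively) embedded in $C(\bar\Omega)$. Let $S:X\to Y$ be a bounded linear operator. Assume that, for some $\gamma<2$ and some constant $A$, the unit ball $SY$ of $Y$ satisfies the covering-entropy bound $$\log N(\varepsilon,SY,\|\cdot\|_{L^\infty(\Omega)})\le A\,\varepsilon^{-\gamma}\qquad\text{for all }\varepsilon>0 .$$ For $n\ge1$ points $x_1,\dots,x_n\in\Omega$ put $\|u\|_n=\big(\frac1n\sum_{i=1}^n u(x_i)^2\big)^{1/2}$. Let $f^*\in X$, $\sigma>0$, and let $m_i=(Sf^*)(x_i)+e_i$, where $e_1,\dots,e_n$ are independent random variables with $\mathbb E[e_i]=0$ and $\mathbb E[e^{t(e_i-\mathbb E[e_i])}]\le e^{\sigma^2t^2/2}$ for all $t\in\mathbb R$. For $\lambda_n>0$ let $f_n\in X$ be the minimizer over $f\in X$ of $$\frac1n\sum_{i=1}^n|(Sf)(x_i)-m_i|^2+\lambda_n\|f\|_X^2 ,$$ and let $\rho_0=\|f^*\|_X+\sigma n^{-1/2}$. Assume that $\lambda_n$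 is chosen so that, with a constant $K$, $$\sigma n^{-1/2}\rho_0^{-1}\le K\,\lambda_n^{1/2+\gamma/4}.$$ Theorem. (i) There is a constant $C>0$, depending only on $\Omega,X,Y,S,\gamma,A,K$ (not on $n$, the points $x_i$, $\sigma$, $\lambda_n$, $f^*$ or the noise), such that for all $z>0$ $$\mathbb P\big(\|Sf_n-Sf^*\|_n\ge\lambda_n^{1/2}\rho_0z\big)\le 2e^{-Cz^2}\quad\text{and}\quad \mathbb P\big(\|f_n\|_X\ge\rho_0z\big)\le2e^{-Cz^2}.$$ (ii) Suppose moreover that $X$ has an orthonormal basis $(\phi_k)_{k\ge1}$ of eigenfunctions, $(\phi_k,v)_X=\eta_k\,(S\phi_k,Sv)_{L^2(\Omega)}$ for all $v\in X$, with $0<\eta_1\le\eta_2\le\cdots$. Let $Z=\{v\in X:\|v\|_Z^2:=\sum_k\eta_k^{1/2}(v,\phi_k)_X^2<\infty\}$ and let $\|v\|_{Z'}=\sup_{0\ne g\in Z}|(v,g)_X|/\|g\|_Z$ be the norm of $v \in X$ in the dual space $Z'$. Given $1<\alpha\le\beta$, a constant $B$ and a constant $c>0$, there is a constant $C>0$,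 depending only on the data in (i) and on $(\phi_k),(\eta_k),\alpha,\beta,B,c$, such that the following holds. If $$\|u\|^2_{L^2(\Omega)}\le B(\|u\|_n^2+n^{-\beta}\|u\|_Y^2),\qquad \|u\|_n^2\le B(\|u\|^2_{L^2(\Omega)}+n^{-\beta}\|u\|_Y^2)\qquad\text{for all }u\in Y,$$ $\eta_k\ge c\,k^\alpha$ for $k=1,\dots,n$, and $n^{-\beta}\le\lambda_n$, then for all $z>0$ $$\mathbb P\big(\|f_n-f^*\|_{Z'}\ge\lambda_n^{1/4}\rho_0z\big)\le2e^{-Cz^2}.$$ -/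

import Mathlib

open MeasureTheory ProbabilityTheory Set Metric
open scoped NNReal BoundedContinuousFunction

namespace InverseSource

noncomputable section

/-- A function `g ∈ C(Ω̄)`, read as a function on all of `ℝ^d` (by zero outside `Ω̄`), so that it
can be evaluated at points of `Ω` and integrated over `Ω`. For a bounded set `Ω` the bounded
continuous functions on `Ω̄` are exactly `C(Ω̄)`, with the maximum norm. -/
def toFun {d : ℕ} {Ω : Set (EuclideanSpace ℝ (Fin d))} (g : closure Ω →ᵇ ℝ) :
    EuclideanSpace ℝ (Fin d) → ℝ :=
  Function.extend Subtype.val g 0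

/-- The inner product `(u, v)` of `L²(Ω)`. -/
def l2Inner {d : ℕ} {Ω : Set (EuclideanSpace ℝ (Fin d))} (u v : closure Ω →ᵇ ℝ) : ℝ :=
  ∫ y in Ω, toFun u y * toFun v y

/-- The empirical semi-norm `‖u‖_n = (n⁻¹ ∑ i, u(x_i)²)^{1/2}`. -/
def empNorm {d n : ℕ} {Ω : Set (EuclideanSpace ℝ (Fin d))}
    (x : Fin n → EuclideanSpace ℝ (Fin d)) (u : closure Ω →ᵇ ℝ) : ℝ :=
  Real.sqrt ((∑ i, toFun u (x i) ^ 2) / n)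

/-- The covering-entropy bound `log N(ε, SY, ‖·‖_{L^∞(Ω)}) ≤ A ε^{-γ}` for all `ε > 0`, where `SY`
is the unit ball of `Y`, regarded as a subset of `C(Ω̄)` through the embedding `ι`. -/
def EntropyBound {d : ℕ} {Ω : Set (EuclideanSpace ℝ (Fin d))} {Y : Type*}
    [NormedAddCommGroup Y] [InnerProductSpace ℝ Y]
    (ι : Y →L[ℝ] (closure Ω →ᵇ ℝ)) (γ A : ℝ) : Prop :=
  ∀ ε : ℝ≥0, 0 < ε →
    coveringNumber ε (ι '' closedBall (0 : Y) 1) ≠ ⊤ ∧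
    Real.log ((coveringNumber ε (ι '' closedBall (0 : Y) 1)).toNat) ≤ A * (ε : ℝ) ^ (-γ)

/-- The noise: independent, centred, sub-Gaussian random variables with parameter `σ`, that is
`E[exp (t (e_i - E e_i))] ≤ exp (σ² t² / 2)` for all real `t`. -/
structure IsSubGaussianNoise {n : ℕ} {𝔛 : Type*} [MeasurableSpace 𝔛] (P : Measure 𝔛) (σ : ℝ)
    (e : Fin n → 𝔛 → ℝ) : Prop where
  measurable : ∀ i, Measurable (e i)
  indep : iIndepFun e P
  mean_zero : ∀ i, ∫ ω, e i ω ∂P = 0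
  subGaussian : ∀ i,
    HasSubgaussianMGF (fun ω => e i ω - ∫ ω', e i ω' ∂P) (Real.toNNReal (σ ^ 2)) P

/-- `f` minimizes `h ↦ n⁻¹ ∑ i, |(T h)(x_i) - m_i|² + lam ‖h‖²` over `X`; here `T : X → C(Ω̄)` is
the forward operator followed by the embedding into `C(Ω̄)`. -/
def IsRegularizedSolution {d n : ℕ} {Ω : Set (EuclideanSpace ℝ (Fin d))} {X : Type*}
    [NormedAddCommGroup X] [InnerProductSpace ℝ X]
    (T : X →L[ℝ] (closure Ω →ᵇ ℝ)) (x : Fin n → EuclideanSpace ℝ (Fin d)) (m : Fin n → ℝ)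
    (lam : ℝ) (f : X) : Prop :=
  IsMinOn (fun h : X => (∑ i, |toFun (T h) (x i) - m i| ^ 2) / n + lam * ‖h‖ ^ 2) univ f

/-- `ρ₀ = ‖f*‖_X + σ n^{-1/2}`. -/
def rho0 {X : Type*} [NormedAddCommGroup X] (n : ℕ) (σ : ℝ) (fstar : X) : ℝ :=
  ‖fstar‖ + σ * (n : ℝ) ^ (-(1 / 2) : ℝ)

/-- All that is assumed on the data of one instance of the regularized problem: `n ≥ 1` points in
`Ω`, measurements `m_i = (T f*)(x_i) + e_i` with sub-Gaussian noise, the (random) minimizer `fn`,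
and the choice of the regularization parameter `lam`, with constant `K` in the `O`-relation
`σ n^{-1/2} ρ₀⁻¹ = O(lam^{1/2 + γ/4})`. -/
structure IsInstance {d n : ℕ} {Ω : Set (EuclideanSpace ℝ (Fin d))} {X : Type*}
    [NormedAddCommGroup X] [InnerProductSpace ℝ X]
    {𝔛 : Type*} [MeasurableSpace 𝔛] (P : Measure 𝔛)
    (T : X →L[ℝ] (closure Ω →ᵇ ℝ)) (γ K : ℝ) (x : Fin n → EuclideanSpace ℝ (Fin d))
    (σ lam : ℝ) (fstar : X) (e : Fin n → 𝔛 → ℝ) (fn : 𝔛 → X) : Prop where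
  n_pos : 0 < n
  points_mem : ∀ i, x i ∈ Ω
  sigma_pos : 0 < σ
  noise : IsSubGaussianNoise P σ e
  lam_pos : 0 < lam
  lam_choice : σ * (n : ℝ) ^ (-(1 / 2) : ℝ) * (rho0 n σ fstar)⁻¹ ≤ K * lam ^ (1 / 2 + γ / 4)
  minimizer : ∀ ω, IsRegularizedSolution T x (fun i => toFun (T fstar) (x i) + e i ω) lam (fn ω)

/-- `(φ_k)` is an orthonormal basis of `X` consisting of eigenfunctions of
`(ψ, v)_X = η (T ψ, T v)_{L²(Ω)}` for all `v ∈ X`, with eigenvalues `0 < η_0 ≤ η_1 ≤ ⋯`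
(numbered from `0`). -/
structure IsEigenbasis {d : ℕ} {Ω : Set (EuclideanSpace ℝ (Fin d))} {X : Type*}
    [NormedAddCommGroup X] [InnerProductSpace ℝ X]
    (T : X →L[ℝ] (closure Ω →ᵇ ℝ)) (φ : HilbertBasis ℕ ℝ X) (η : ℕ → ℝ) : Prop where
  pos : ∀ k, 0 < η k
  mono : Monotone η
  eigen : ∀ k, ∀ v : X, inner ℝ (φ k) v = η k * l2Inner (T (φ k)) (T v)

/-- The assumptions relating the `L²(Ω)` norm, the empirical norm and the growth of the first `n`
eigenvalues: `‖u‖²_{L²} ≤ B (‖u‖²_n + n^{-β} ‖u‖²_Y)`, `‖u‖²_n ≤ B (‖u‖²_{L²} + n^{-β} ‖u‖²_Y)` for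
all `u ∈ Y`, with `β > 1`, and `η_k ≥ c k^α` for `k = 1, …, n`, with `c > 0` and `1 < α ≤ β`
(the `k`-th eigenvalue is `η (k - 1)`). -/
structure SamplingSpectralAssumption {d n : ℕ} {Ω : Set (EuclideanSpace ℝ (Fin d))} {Y : Type*}
    [NormedAddCommGroup Y] [InnerProductSpace ℝ Y]
    (ι : Y →L[ℝ] (closure Ω →ᵇ ℝ)) (x : Fin n → EuclideanSpace ℝ (Fin d)) (η : ℕ → ℝ)
    (α β B c : ℝ) : Prop where
  one_lt_beta : 1 < β
  l2_le : ∀ u : Y,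
    l2Inner (ι u) (ι u) ≤ B * (empNorm x (ι u) ^ 2 + (n : ℝ) ^ (-β) * ‖u‖ ^ 2)
  emp_le : ∀ u : Y,
    empNorm x (ι u) ^ 2 ≤ B * (l2Inner (ι u) (ι u) + (n : ℝ) ^ (-β) * ‖u‖ ^ 2)
  one_lt_alpha : 1 < α
  alpha_le_beta : α ≤ β
  c_pos : 0 < c
  eigen_growth : ∀ k : ℕ, k < n → c * ((k : ℝ) + 1) ^ α ≤ η k

/-- Membership in `Z = {v ∈ X : ∑ k, η_k^{1/2} v_k² < ∞}`, `v_k` the coefficient of `v` in the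
basis `φ`. -/
def MemZ {X : Type*} [NormedAddCommGroup X] [InnerProductSpace ℝ X]
    (φ : HilbertBasis ℕ ℝ X) (η : ℕ → ℝ) (v : X) : Prop :=
  Summable fun k => Real.sqrt (η k) * inner ℝ (φ k) v ^ 2

/-- The norm `‖v‖_Z = (∑ k, η_k^{1/2} v_k²)^{1/2}` of an element of `Z`. -/
def normZ {X : Type*} [NormedAddCommGroup X] [InnerProductSpace ℝ X]
    (φ : HilbertBasis ℕ ℝ X) (η : ℕ → ℝ) (v : X) : ℝ :=
  Real.sqrt (∑' k, Real.sqrt (η k) * inner ℝ (φ k) v ^ 2)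

/-- The norm of `v ∈ X` in the dual space `Z'`, where `v` acts on `Z` through the inner product
of `X`: `‖v‖_{Z'} = sup {|(v, g)_X| / ‖g‖_Z : 0 ≠ g ∈ Z}`. -/
def normZDual {X : Type*} [NormedAddCommGroup X] [InnerProductSpace ℝ X]
    (φ : HilbertBasis ℕ ℝ X) (η : ℕ → ℝ) (v : X) : ℝ :=
  sSup {t : ℝ | ∃ g : X, MemZ φ η g ∧ g ≠ 0 ∧ t = |inner ℝ v g| / normZ φ η g}

end

end InverseSource

namespace InverseSource

/-! Everything is read off one quantity, the energy `‖T v‖_n² + lam ‖v‖²` of the error `v = f_n -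
f*`, where `T = ι ∘ S`. Minimality gives the deterministic inequality `energy ≤ n⁻¹ ∑ e_i (T v)(x_i)
- lam (f*, v)` (`IsRegularizedSolution.regEnergy_le`). The second term is at most `lam^{1/2} ‖f*‖`
times the square root of the energy, so it remains to bound the noise term by `lam^{1/2} ρ₀` times
that square root, uniformly in `v`.

By homogeneity `v` can be normalized to unit energy. Then `T v` has empirical norm at most 1, and `S
v` lies in a ball of `Y` of radius `r ~ lam^{-1/2}`. Dyadic chaining over this class
(`IsSubGaussianNoise.chaining`), with nets supplied by the entropy bound, controls the noise by `σ
n^{1/2} r^{γ/2}`; the entropy series converges because `γ < 2`. After division by `n` this is of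
order `σ n^{-1/2} lam^{-γ/4}`, which the choice of `lam` makes at most a constant times `lam^{1/2}
ρ₀`. Since one event serves all `v`, no peeling over the size of the error is needed.

Part (i) follows because the energy dominates `‖T v‖_n²` and `lam ‖v‖²`. For part (ii), the
functions `T φ_k` are orthogonal in `L²(Ω)` with squared norms `1/η_k`, so `Z'` interpolates halfway
between the `L²` norm of `T v` and the norm of `X` (`IsEigenbasis.normZDual_sq_le`). The sampling
inequality together with `n^{-β} ≤ lam` bounds the former by the energy. -/

/-! ### Sub-Gaussian linear forms and chaining -/

lemma IsSubGaussianNoise.tail {n : ℕ} {𝔛 : Type*} [MeasurableSpace 𝔛] {P : Measure 𝔛}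
    [IsProbabilityMeasure P] {σ : ℝ} {e : Fin n → 𝔛 → ℝ} (he : IsSubGaussianNoise P σ e)
    (hσ : 0 < σ) {a : EuclideanSpace ℝ (Fin n)} {ρ s : ℝ} (hρ : 0 < ρ) (ha : ‖a‖ ≤ ρ)
    (hs : 0 ≤ s) :
    P.real {ω | σ * ρ * s ≤ |∑ i, e i ω * a i|} ≤ 2 * Real.exp (-(s ^ 2 / 2)) := by
  have hsub : ∀ b : EuclideanSpace ℝ (Fin n), ‖b‖ ≤ ρ →
      P.real {ω | σ * ρ * s ≤ ∑ i, b i * e i ω} ≤ Real.exp (-(s ^ 2 / 2)) := by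
    intro b hb
    have h1 : ∀ i, HasSubgaussianMGF (e i) (Real.toNNReal (σ ^ 2)) P := fun i => by
      have := he.subGaussian i
      simpa [he.mean_zero i] using this
    have h1' : ∀ i, HasSubgaussianMGF (fun ω => b i * e i ω)
        (Real.toNNReal (b i ^ 2 * σ ^ 2)) P := fun i => by
      refine ⟨((h1 i).const_mul (b i)).integrable_exp_mul, fun t =>
        (((h1 i).const_mul (b i)).mgf_le t).trans_eq ?_⟩
      change Real.exp (b i ^ 2 * (Real.toNNReal (σ ^ 2) : ℝ) * t ^ 2 / 2) = _
      rw [Real.coe_toNNReal _ (by positivity), Real.coe_toNNReal _ (by positivity)]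
    have h2 := HasSubgaussianMGF.sum_of_iIndepFun (s := Finset.univ)
      (he.indep.comp (fun i y => b i * y) (fun i => measurable_const_mul (b i)))
      (fun i _ => h1' i)
    have h3 : HasSubgaussianMGF (fun ω => ∑ i, b i * e i ω) (Real.toNNReal (σ ^ 2 * ρ ^ 2)) P := by
      refine ⟨h2.integrable_exp_mul, fun t => (h2.mgf_le t).trans ?_⟩
      refine Real.exp_le_exp.2 ?_
      have hb2 : ∑ i, b i ^ 2 ≤ ρ ^ 2 := by
        have := EuclideanSpace.real_norm_sq_eq b
        rw [← this]
        gcongr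
      rw [Real.coe_toNNReal _ (by positivity), NNReal.coe_sum]
      simp only [Real.coe_toNNReal _ (mul_nonneg (sq_nonneg (b _)) (sq_nonneg σ))]
      have : ∑ i, (b i ^ 2) * σ ^ 2 ≤ σ ^ 2 * ρ ^ 2 := by
        rw [← Finset.sum_mul, mul_comm]
        gcongr
      gcongr
    refine (h3.measure_ge_le (by positivity)).trans_eq ?_
    rw [Real.coe_toNNReal _ (by positivity)]
    congr 1
    field_simp
  have hset : {ω | σ * ρ * s ≤ |∑ i, e i ω * a i|} ⊆
      {ω | σ * ρ * s ≤ ∑ i, a i * e i ω} ∪ {ω | σ * ρ * s ≤ ∑ i, (-a) i * e i ω} := by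
    intro ω hω
    simp only [mem_ofPred_eq, le_abs] at hω
    rcases hω with h | h
    · left
      simpa only [mem_ofPred_eq, mul_comm] using h
    · right
      simpa [mul_comm] using h
  calc _ ≤ _ := measureReal_mono hset
    _ ≤ _ := measureReal_union_le _ _
    _ ≤ Real.exp (-(s ^ 2 / 2)) + Real.exp (-(s ^ 2 / 2)) :=
        add_le_add (hsub a ha) (hsub (-a) (by rwa [norm_neg]))
    _ = _ := by ring

lemma abs_sum_mul_le {n : ℕ} (y : Fin n → ℝ) (a : EuclideanSpace ℝ (Fin n)) :
    |∑ i, y i * a i| ≤ ‖WithLp.toLp 2 y‖ * ‖a‖ := by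
  have := abs_real_inner_le_norm (WithLp.toLp 2 y) a
  rw [real_inner_comm] at this
  simpa [PiLp.inner_apply, mul_comm ‖a‖] using this

/-- Chaining bound for the supremum of a sub-Gaussian process over a set `G` with nets `N j`. -/
lemma IsSubGaussianNoise.chaining {n : ℕ} {𝔛 : Type*} [MeasurableSpace 𝔛] {P : Measure 𝔛}
    [IsProbabilityMeasure P] {σ : ℝ} {e : Fin n → 𝔛 → ℝ} (he : IsSubGaussianNoise P σ e)
    (hσ : 0 < σ) {G : Set (EuclideanSpace ℝ (Fin n))}
    (N : ℕ → Finset (EuclideanSpace ℝ (Fin n))) (hN0 : N 0 = {0}) {D : ℝ} (hD : 0 < D)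
    (hnet : ∀ j, ∀ a ∈ G, ∃ p ∈ N j, ‖a - p‖ ≤ D * (1 / 2) ^ j)
    {H s : ℕ → ℝ} (hcard : ∀ j, ((N j).card : ℝ) ≤ Real.exp (H j)) (hs : ∀ j, 0 ≤ s j)
    {t T : ℝ} (ht : 1 ≤ t) (hsH : ∀ j, H j + H (j + 1) + t ^ 2 * (j + 2) ≤ s j ^ 2 / 2)
    (hT : ∀ J, ∑ j ∈ Finset.range J, σ * (2 * D * (1 / 2) ^ j) * s j ≤ T) :
    P.real {ω | ¬ ∀ a ∈ G, |∑ i, e i ω * a i| ≤ T} ≤ 2 * Real.exp (-t ^ 2) := by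
  classical
  -- A link joins net points at levels `j` and `j + 1` that approximate the same `a`; its length is
  -- at most `(3/2) D 2^{-j}`, hence at most `R j`.
  set R : ℕ → ℝ := fun j => 2 * D * (1 / 2) ^ j with hR
  have hRpos : ∀ j, 0 < R j := fun j => by positivity
  set Q : ℕ → Finset (EuclideanSpace ℝ (Fin n) × EuclideanSpace ℝ (Fin n)) := fun j =>
    (N j ×ˢ N (j + 1)).filter fun p => ‖p.2 - p.1‖ ≤ R j with hQ
  set Bad : ℕ → Set 𝔛 := fun j =>
    ⋃ p ∈ Q j, {ω | σ * R j * s j ≤ |∑ i, e i ω * (p.2 - p.1) i|} with hBad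
  have hBadle : ∀ j, P.real (Bad j) ≤ 2 * Real.exp (-t ^ 2) * (1 / 2) ^ (j + 1) := by
    intro j
    have hexp : Real.exp (-1) ≤ 1 / 2 := by
      rw [Real.exp_neg, ← one_div]
      exact one_div_le_one_div_of_le (by norm_num) (by linarith [Real.add_one_le_exp (1 : ℝ)])
    calc P.real (Bad j) ≤ ∑ p ∈ Q j, P.real {ω | σ * R j * s j ≤ |∑ i, e i ω * (p.2 - p.1) i|} :=
          measureReal_biUnion_finset_le _ _
      _ ≤ ∑ p ∈ Q j, 2 * Real.exp (-(s j ^ 2 / 2)) := by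
          refine Finset.sum_le_sum fun p hp => he.tail hσ (hRpos j) ?_ (hs j)
          exact (Finset.mem_filter.1 hp).2
      _ = (Q j).card * (2 * Real.exp (-(s j ^ 2 / 2))) := by rw [Finset.sum_const, nsmul_eq_mul]
      _ ≤ (Real.exp (H j) * Real.exp (H (j + 1))) * (2 * Real.exp (-(s j ^ 2 / 2))) := by
          refine mul_le_mul_of_nonneg_right ?_ (by positivity)
          calc ((Q j).card : ℝ) ≤ ((N j ×ˢ N (j + 1)).card : ℝ) := by
                exact_mod_cast Finset.card_filter_le _ _
            _ = (N j).card * (N (j + 1)).card := by rw [Finset.card_product]; push_cast; rfl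
            _ ≤ _ := mul_le_mul (hcard j) (hcard (j + 1)) (by positivity) (by positivity)
      _ = 2 * Real.exp (H j + H (j + 1) - s j ^ 2 / 2) := by
          rw [sub_eq_add_neg, Real.exp_add, Real.exp_add]; ring
      -- The reserve `t² (j + 2)` in `hsH` is at least `t² + (j + 1)` since `t ≥ 1`. The surplus
      -- `e^{-(j+1)} ≤ 2^{-(j+1)}` makes the union bound summable over levels.
      _ ≤ 2 * Real.exp (-t ^ 2 + ((j + 1 : ℕ) : ℝ) * (-1)) := by
          gcongr
          have := hsH j
          push_cast
          have h1 : (1 : ℝ) ≤ t ^ 2 := one_le_pow₀ ht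
          have hj : (0 : ℝ) ≤ j + 1 := by positivity
          nlinarith
      _ ≤ 2 * Real.exp (-t ^ 2) * (1 / 2) ^ (j + 1) := by
          rw [Real.exp_add, Real.exp_nat_mul, ← mul_assoc]
          gcongr
  have hsub : {ω | ¬ ∀ a ∈ G, |∑ i, e i ω * a i| ≤ T} ⊆ ⋃ j, Bad j := by
    intro ω hω
    by_contra hcon
    apply hω
    intro a ha
    have hgood : ∀ j, ∀ p ∈ Q j, |∑ i, e i ω * (p.2 - p.1) i| ≤ σ * R j * s j := by
      intro j p hp
      by_contra h
      refine hcon (mem_iUnion.2 ⟨j, mem_iUnion₂.2 ⟨p, hp, ?_⟩⟩)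
      exact (not_le.1 h).le
    choose π hπN hπ using fun j => hnet j a ha
    have hπ0 : π 0 = 0 := by
      have := hπN 0
      rwa [hN0, Finset.mem_singleton] at this
    have hQmem : ∀ j, (π j, π (j + 1)) ∈ Q j := by
      intro j
      refine Finset.mem_filter.2 ⟨Finset.mem_product.2 ⟨hπN j, hπN (j + 1)⟩, ?_⟩
      have h1 := hπ j
      have h2 := hπ (j + 1)
      calc ‖π (j + 1) - π j‖ = ‖(a - π j) - (a - π (j + 1))‖ := by congr 1; abel
        _ ≤ ‖a - π j‖ + ‖a - π (j + 1)‖ := norm_sub_le _ _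
        _ ≤ D * (1 / 2) ^ j + D * (1 / 2) ^ (j + 1) := add_le_add h1 h2
        _ ≤ R j := by
          rw [hR, pow_succ]
          have : 0 < D * (1 / 2) ^ j := by positivity
          dsimp only
          linarith
    have hpart : ∀ J, |∑ i, e i ω * π J i| ≤ ∑ j ∈ Finset.range J, σ * R j * s j := by
      intro J
      induction J with
      | zero => simp [hπ0]
      | succ J ih =>
        rw [Finset.sum_range_succ]
        have h1 := hgood J _ (hQmem J)
        have h2 : ∑ i, e i ω * π (J + 1) i =
            ∑ i, e i ω * π J i + ∑ i, e i ω * (π (J + 1) - π J) i := by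
          rw [← Finset.sum_add_distrib]
          refine Finset.sum_congr rfl fun i _ => ?_
          rw [PiLp.sub_apply]; ring
        rw [h2]
        exact (abs_add_le _ _).trans (add_le_add ih h1)
    -- For fixed `ω` the remainder beyond level `J` is bounded by Cauchy–Schwarz and tends to 0.
    -- Only countably many links enter, and outer measure suffices, so the supremum over `G` need
    -- not be measurable.
    have hall : ∀ J : ℕ, |∑ i, e i ω * a i| ≤
        T + ‖WithLp.toLp 2 (fun i => e i ω)‖ * (D * (1 / 2) ^ J) := by
      intro J
      have h2 : ∑ i, e i ω * a i = ∑ i, e i ω * π J i + ∑ i, e i ω * (a - π J) i := by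
        rw [← Finset.sum_add_distrib]
        refine Finset.sum_congr rfl fun i _ => ?_
        rw [PiLp.sub_apply]; ring
      rw [h2]
      refine (abs_add_le _ _).trans (add_le_add ((hpart J).trans (hT J)) ?_)
      refine (abs_sum_mul_le _ _).trans ?_
      gcongr
      exact hπ J
    have hlim : Filter.Tendsto
        (fun J : ℕ => T + ‖WithLp.toLp 2 (fun i => e i ω)‖ * (D * (1 / 2) ^ J)) Filter.atTop
        (nhds (T + ‖WithLp.toLp 2 (fun i => e i ω)‖ * (D * 0))) :=
      ((((tendsto_pow_atTop_nhds_zero_of_lt_one (by norm_num) (by norm_num)).const_mul D).const_mul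
        _).const_add T)
    simpa using ge_of_tendsto' hlim hall
  have hsum : HasSum (fun j : ℕ => 2 * Real.exp (-t ^ 2) * (1 / 2 : ℝ) ^ (j + 1))
      (2 * Real.exp (-t ^ 2)) := by
    have := (hasSum_geometric_two.mul_left (1 / 2 : ℝ)).mul_left (2 * Real.exp (-t ^ 2))
    rw [show (1 / 2 : ℝ) * 2 = 1 by norm_num, mul_one] at this
    simpa only [pow_succ'] using this
  refine ENNReal.toReal_le_of_le_ofReal (by positivity) ?_
  calc P {ω | ¬ ∀ a ∈ G, |∑ i, e i ω * a i| ≤ T} ≤ P (⋃ j, Bad j) := measure_mono hsub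
    _ ≤ ∑' j, P (Bad j) := measure_iUnion_le _
    _ ≤ ∑' j, ENNReal.ofReal (2 * Real.exp (-t ^ 2) * (1 / 2) ^ (j + 1)) := by
        refine ENNReal.tsum_le_tsum fun j => ?_
        rw [← ofReal_measureReal (measure_ne_top _ _)]
        exact ENNReal.ofReal_le_ofReal (hBadle j)
    _ = ENNReal.ofReal (2 * Real.exp (-t ^ 2)) := by
        rw [← ENNReal.ofReal_tsum_of_nonneg (fun j => by positivity) hsum.summable, hsum.tsum_eq]

/-! ### Nets from the entropy bound -/

lemma EntropyBound.exists_net {d : ℕ} {Ω : Set (EuclideanSpace ℝ (Fin d))} {Y : Type*}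
    [NormedAddCommGroup Y] [InnerProductSpace ℝ Y] {ι : Y →L[ℝ] (closure Ω →ᵇ ℝ)} {γ A : ℝ}
    (h : EntropyBound ι γ A) {ε : ℝ} (hε : 0 < ε) :
    ∃ C : Finset (closure Ω →ᵇ ℝ), (C.card : ℝ) ≤ Real.exp (A * ε ^ (-γ)) ∧
      ∀ u : Y, ‖u‖ ≤ 1 → ∃ p ∈ C, ‖ι u - p‖ ≤ ε := by
  lift ε to ℝ≥0 using hε.le
  obtain ⟨hfin, hlog⟩ := h ε (by exact_mod_cast hε)
  obtain ⟨C, -, hCfin, hcov, hcard⟩ := exists_set_encard_eq_coveringNumber hfin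
  refine ⟨hCfin.toFinset, ?_, fun u hu => ?_⟩
  · have hc : (coveringNumber ε (ι '' closedBall (0 : Y) 1)).toNat = hCfin.toFinset.card := by
      rw [← hcard, hCfin.encard_eq_coe_toFinset_card, ENat.toNat_natCast]
    rw [hc] at hlog
    exact Real.le_exp_of_log_le hlog
  · obtain ⟨p, hp, hup⟩ := hcov (mem_image_of_mem ι (by simpa using hu : u ∈ closedBall (0 : Y) 1))
    refine ⟨p, by simpa using hp, ?_⟩
    rw [← dist_eq_norm]
    have : edist (ι u) p ≤ ε := hup
    rw [edist_nndist] at this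
    exact_mod_cast this

/-- If `γ ≤ 0`, the covering numbers stay bounded as `ε → 0`, whereas a nonzero `ι u` spans a
segment containing arbitrarily many separated points. This settles the degenerate exponents, to
which the chaining sum does not apply. -/
lemma EntropyBound.eq_zero {d : ℕ} {Ω : Set (EuclideanSpace ℝ (Fin d))} {Y : Type*}
    [NormedAddCommGroup Y] [InnerProductSpace ℝ Y] {ι : Y →L[ℝ] (closure Ω →ᵇ ℝ)} {γ A : ℝ}
    (h : EntropyBound ι γ A) (hγ : γ ≤ 0) (u : Y) : ι u = 0 := by
  have key : ∀ u : Y, ‖u‖ ≤ 1 → ι u = 0 := by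
    intro u hu
    by_contra hne
    have hpos : 0 < ‖ι u‖ := norm_pos_iff.2 hne
    obtain ⟨m, hm⟩ := exists_nat_gt (max (Real.exp (max A 0)) ‖ι u‖)
    have hm1 : Real.exp (max A 0) < m := (le_max_left _ _).trans_lt hm
    have hm2 : ‖ι u‖ < m := (le_max_right _ _).trans_lt hm
    have hm0 : (0 : ℝ) < m := (norm_nonneg _).trans_lt hm2
    -- The points `ι ((k/m) u)` are at least `3ε` apart, so no net point can serve two of them;
    -- there are `m` of them and fewer than `m` net points.
    set ε : ℝ := ‖ι u‖ / (3 * m) with hεdef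
    have hε : 0 < ε := by positivity
    have hε1 : ε ≤ 1 := by
      rw [hεdef, div_le_one (by positivity)]
      linarith
    obtain ⟨C, hcard, hC⟩ := h.exists_net hε
    have hcard' : C.card < m := by
      have : (C.card : ℝ) < m := by
        refine (hcard.trans (Real.exp_le_exp.2 ?_)).trans_lt hm1
        have h1 : ε ^ (-γ) ≤ 1 := Real.rpow_le_one hε.le hε1 (by linarith)
        have h0 : 0 ≤ ε ^ (-γ) := by positivity
        calc A * ε ^ (-γ) ≤ max A 0 * ε ^ (-γ) := by gcongr; exact le_max_left _ _
          _ ≤ max A 0 * 1 := by gcongr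
          _ = _ := mul_one _
      exact_mod_cast this
    have hball : ∀ k : Fin m, ‖((k : ℕ) / (m : ℝ)) • u‖ ≤ 1 := by
      intro k
      rw [norm_smul, Real.norm_of_nonneg (by positivity)]
      have : ((k : ℕ) : ℝ) ≤ m := by exact_mod_cast k.2.le
      have : ((k : ℕ) / (m : ℝ)) ≤ 1 := (div_le_one hm0).2 this
      exact mul_le_one₀ this (norm_nonneg _) hu
    choose q hqC hq using fun k : Fin m => hC _ (hball k)
    obtain ⟨k, -, l, -, hkl, heq⟩ := Finset.exists_ne_map_eq_of_card_lt_of_maps_to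
      (s := (Finset.univ : Finset (Fin m))) (t := C) (by simpa using hcard')
      (f := q) (fun k _ => hqC k)
    have h1 : ‖ι (((k : ℕ) / (m : ℝ)) • u) - ι (((l : ℕ) / (m : ℝ)) • u)‖ ≤ ε + ε := by
      have h2 := hq k
      have h3 := hq l
      rw [heq] at h2
      rw [← dist_eq_norm] at h2 h3 ⊢
      exact (dist_triangle_right _ _ (q l)).trans (add_le_add h2 h3)
    rw [← map_sub, ← sub_smul, map_smul, norm_smul, ← sub_div, norm_div, Real.norm_eq_abs,
      Real.norm_of_nonneg hm0.le] at h1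
    have h4 : (1 : ℝ) ≤ |((k : ℕ) : ℝ) - ((l : ℕ) : ℝ)| := by
      have : ((k : ℕ) : ℤ) - ((l : ℕ) : ℤ) ≠ 0 := by
        intro h
        apply hkl
        ext
        omega
      exact_mod_cast Int.one_le_abs this
    have h5 : 1 / m * ‖ι u‖ ≤ ε + ε := by
      refine le_trans ?_ h1
      gcongr
    rw [hεdef] at h5
    have h6 : 1 / m * ‖ι u‖ = 3 * (‖ι u‖ / (3 * m)) := by field_simp
    linarith
  by_cases hu : u = 0
  · simp [hu]
  · have := key (‖u‖⁻¹ • u) (by rw [norm_smul, norm_inv, norm_norm, inv_mul_cancel₀ (by simpa)])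
    rw [map_smul, smul_eq_zero] at this
    exact this.resolve_left (by simpa using hu)

/-! ### Functions as vectors of samples -/

section Sampling

variable {d n : ℕ} {Ω : Set (EuclideanSpace ℝ (Fin d))}

lemma toFun_of_mem (u : closure Ω →ᵇ ℝ) {y : EuclideanSpace ℝ (Fin d)} (hy : y ∈ closure Ω) :
    toFun u y = u ⟨y, hy⟩ :=
  Subtype.val_injective.extend_apply u 0 ⟨y, hy⟩

lemma toFun_of_notMem (u : closure Ω →ᵇ ℝ) {y : EuclideanSpace ℝ (Fin d)} (hy : y ∉ closure Ω) :
    toFun u y = 0 :=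
  Function.extend_apply' _ _ _ fun ⟨z, hz⟩ => hy (hz ▸ z.2)

lemma toFun_add (u v : closure Ω →ᵇ ℝ) (y : EuclideanSpace ℝ (Fin d)) :
    toFun (u + v) y = toFun u y + toFun v y := by
  by_cases hy : y ∈ closure Ω
  · simp [toFun_of_mem _ hy]
  · simp [toFun_of_notMem _ hy]

lemma toFun_smul (c : ℝ) (u : closure Ω →ᵇ ℝ) (y : EuclideanSpace ℝ (Fin d)) :
    toFun (c • u) y = c * toFun u y := by
  by_cases hy : y ∈ closure Ω
  · simp [toFun_of_mem _ hy]
  · simp [toFun_of_notMem _ hy]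

lemma abs_toFun_le (u : closure Ω →ᵇ ℝ) (y : EuclideanSpace ℝ (Fin d)) : |toFun u y| ≤ ‖u‖ := by
  by_cases hy : y ∈ closure Ω
  · rw [toFun_of_mem _ hy]
    exact u.norm_coe_le_norm _
  · simp [toFun_of_notMem _ hy]

/-- The vector of samples of a function at the points `x`. -/
noncomputable def sample (x : Fin n → EuclideanSpace ℝ (Fin d)) :
    (closure Ω →ᵇ ℝ) →ₗ[ℝ] EuclideanSpace ℝ (Fin n) where
  toFun u := WithLp.toLp 2 fun i => InverseSource.toFun u (x i)
  map_add' u v := by ext i; simp [toFun_add]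
  map_smul' c u := by ext i; simp [toFun_smul]

lemma norm_sample_le (x : Fin n → EuclideanSpace ℝ (Fin d)) (u : closure Ω →ᵇ ℝ) :
    ‖sample x u‖ ≤ Real.sqrt n * ‖u‖ := by
  rw [EuclideanSpace.norm_eq, ← Real.sqrt_sq (norm_nonneg u), ← Real.sqrt_mul (by positivity)]
  refine Real.sqrt_le_sqrt ?_
  calc ∑ i, ‖sample x u i‖ ^ 2 ≤ ∑ _i : Fin n, ‖u‖ ^ 2 := by
        gcongr with i
        exact abs_toFun_le u (x i)
    _ = n * ‖u‖ ^ 2 := by simp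

lemma norm_sample_sq (x : Fin n → EuclideanSpace ℝ (Fin d)) (u : closure Ω →ᵇ ℝ) :
    ‖sample x u‖ ^ 2 = ∑ i, toFun u (x i) ^ 2 :=
  EuclideanSpace.real_norm_sq_eq _

lemma empNorm_eq (x : Fin n → EuclideanSpace ℝ (Fin d)) (u : closure Ω →ᵇ ℝ) :
    empNorm x u = ‖sample x u‖ / Real.sqrt n := by
  rw [empNorm, ← norm_sample_sq, Real.sqrt_div (by positivity), Real.sqrt_sq (norm_nonneg _)]

lemma empNorm_sq (x : Fin n → EuclideanSpace ℝ (Fin d)) (u : closure Ω →ᵇ ℝ) :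
    empNorm x u ^ 2 = (∑ i, toFun u (x i) ^ 2) / n :=
  Real.sq_sqrt (by positivity)

lemma empNorm_smul (x : Fin n → EuclideanSpace ℝ (Fin d)) (c : ℝ) (u : closure Ω →ᵇ ℝ) :
    empNorm x (c • u) = |c| * empNorm x u := by
  rw [empNorm_eq, empNorm_eq, map_smul, norm_smul, Real.norm_eq_abs, mul_div_assoc]

end Sampling

/-! ### Uniform control of the noise -/

set_option maxHeartbeats 1000000 in
/-- Uniform bound for the noise, tested against a ball of `Y` intersected with the unit ball of
the empirical norm. -/
lemma EntropyBound.exists_noise_bound {d : ℕ} {Ω : Set (EuclideanSpace ℝ (Fin d))} {Y : Type*}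
    [NormedAddCommGroup Y] [InnerProductSpace ℝ Y] {ι : Y →L[ℝ] (closure Ω →ᵇ ℝ)} {γ A : ℝ}
    (h : EntropyBound ι γ A) (hγ0 : 0 < γ) (hγ2 : γ < 2) :
    ∃ M : ℝ, 0 < M ∧ ∀ (n : ℕ) (x : Fin n → EuclideanSpace ℝ (Fin d)) (σ : ℝ)
      (𝔛 : Type*) [MeasurableSpace 𝔛] (P : Measure 𝔛) [IsProbabilityMeasure P]
      (e : Fin n → 𝔛 → ℝ), 0 < n → 0 < σ → IsSubGaussianNoise P σ e →
      ∀ r t : ℝ, 0 < r → 1 ≤ t →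
        P.real {ω | ¬ ∀ u : Y, empNorm x (ι u) ≤ 1 → ‖u‖ ≤ r →
          |∑ i, e i ω * toFun (ι u) (x i)| ≤ M * t * (σ * Real.sqrt n * r ^ (γ / 2))} ≤
        2 * Real.exp (-t ^ 2) := by
  classical
  set I : ℝ := ‖ι‖ + 1 with hI
  have hIpos : 0 < I := by positivity
  set A' : ℝ := max A 0 with hA'
  have hA'0 : 0 ≤ A' := le_max_right _ _
  set b : ℝ := 2 ^ (γ / 2) with hb
  have hb1 : 1 < b := Real.one_lt_rpow (by norm_num) (by linarith)
  have hb2 : b < 2 := by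
    calc b < 2 ^ (1 : ℝ) := Real.rpow_lt_rpow_of_exponent_lt (by norm_num) (by linarith)
      _ = 2 := Real.rpow_one 2
  set κ0 : ℝ := (I⁻¹ ^ (γ / 2)) ^ 2 with hκ0
  have hκ0pos : 0 < κ0 := by positivity
  set δ : ℝ := min (1 / 2) (b ^ 2 - 1) with hδ
  have hδpos : 0 < δ := lt_min (by norm_num) (by nlinarith)
  -- In `s1² / 2`, the part `5 A'` pays for two consecutive entropies, as `1 + b² ≤ 5`, and `1 / (κ0
  -- δ)` pays for the reserve `t² (j + 2)`.
  set s1 : ℝ := Real.sqrt (10 * A' + 2 / (κ0 * δ)) with hs1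
  have hs1sq : s1 ^ 2 = 10 * A' + 2 / (κ0 * δ) := Real.sq_sqrt (by positivity)
  have hs1pos : 0 < s1 := Real.sqrt_pos.2 (by positivity)
  have hq : 0 < 1 - b / 2 := by linarith
  refine ⟨2 * s1 / (1 - b / 2), by positivity, ?_⟩
  intro n x σ 𝔛 _ P _ e hn hσ he r t hr ht
  have hnpos : 0 < Real.sqrt n := Real.sqrt_pos.2 (by exact_mod_cast hn)
  -- The class has radius at most `√n D0`, by the empirical bound and by the sup-norm bound `I r`.
  -- Using the smaller one keeps `r / D0 ≥ 1 / I`, so `κ` is bounded below even for small `r` and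
  -- the constant is uniform in `r`.
  set D0 : ℝ := min 1 (I * r) with hD0
  have hD0pos : 0 < D0 := lt_min one_pos (by positivity)
  set κ : ℝ := (r / D0) ^ (γ / 2) with hκ
  have hκpos : 0 < κ := by positivity
  have hκκ0 : κ0 ≤ κ ^ 2 := by
    rw [hκ0, hκ]
    gcongr
    rw [inv_eq_one_div, div_le_div_iff₀ hIpos hD0pos, one_mul, mul_comm]
    exact min_le_right _ _
  -- Here `D0 κ = r^{γ/2} D0^{1 - γ/2}`, with `D0 ≤ 1` and `γ < 2`.
  have hDκ : D0 * κ ≤ r ^ (γ / 2) := by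
    rw [hκ, Real.div_rpow hr.le hD0pos.le, ← mul_div_assoc, mul_comm, mul_div_assoc]
    refine mul_le_of_le_one_right (by positivity) ((div_le_one (by positivity)).2 ?_)
    calc D0 = D0 ^ (1 : ℝ) := (Real.rpow_one _).symm
      _ ≤ D0 ^ (γ / 2) :=
        Real.rpow_le_rpow_of_exponent_ge hD0pos (min_le_left _ _) (by linarith)
  set ε : ℕ → ℝ := fun j => D0 / r * (1 / 2) ^ j with hε
  have hεpos : ∀ j, 0 < ε j := fun j => by positivity
  have hεγ : ∀ j, ε j ^ (-γ) = (κ * b ^ j) ^ 2 := by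
    intro j
    have h1 : (ε j)⁻¹ = r / D0 * 2 ^ j := by
      rw [hε]
      simp [mul_comm]
    have h2 : κ * b ^ j = (ε j)⁻¹ ^ (γ / 2) := by
      rw [h1, Real.mul_rpow (by positivity) (by positivity), hκ, hb, ← Real.rpow_natCast,
        ← Real.rpow_natCast, ← Real.rpow_mul (by norm_num), ← Real.rpow_mul (by norm_num),
        mul_comm (γ / 2)]
    rw [h2, ← Real.rpow_natCast, ← Real.rpow_mul (inv_nonneg.2 (hεpos j).le),
      Real.inv_rpow (hεpos j).le, Real.rpow_neg (hεpos j).le]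
    congr 2
    push_cast
    ring
  choose C hCcard hC using fun j => h.exists_net (hεpos j)
  set N : ℕ → Finset (EuclideanSpace ℝ (Fin n)) := fun j =>
    if j = 0 then {0} else (C j).image fun p => r • sample x p with hN
  have key := he.chaining hσ (G := {a | ∃ u : Y, empNorm x (ι u) ≤ 1 ∧ ‖u‖ ≤ r ∧
    a = sample x (ι u)}) N (by simp [hN]) (D := Real.sqrt n * D0) (by positivity) ?_
    (H := fun j => A' * (κ * b ^ j) ^ 2) (s := fun j => t * s1 * (κ * b ^ j)) ?_
    (fun j => by positivity) (t := t)
    (T := 2 * s1 / (1 - b / 2) * t * (σ * Real.sqrt n * r ^ (γ / 2))) ht ?_ ?_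
  · refine (measureReal_mono ?_).trans key
    intro ω hω hall
    exact hω fun u hu1 hu2 => hall _ ⟨u, hu1, hu2, rfl⟩
  · rintro j a ⟨u, hu1, hu2, rfl⟩
    by_cases hj : j = 0
    · refine ⟨0, by simp [hN, hj], ?_⟩
      rw [hj, sub_zero, pow_zero, mul_one, hD0, mul_min_of_nonneg _ _ hnpos.le, mul_one]
      refine le_min ?_ ?_
      · rwa [empNorm_eq, div_le_one hnpos] at hu1
      · refine (norm_sample_le x _).trans ?_
        gcongr
        calc ‖ι u‖ ≤ ‖ι‖ * ‖u‖ := ι.le_opNorm u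
          _ ≤ I * r := by gcongr; linarith
    · obtain ⟨p, hp, hup⟩ := hC j (r⁻¹ • u) (by
        rw [norm_smul, norm_inv, Real.norm_of_nonneg hr.le, inv_mul_le_iff₀ hr, mul_one]
        exact hu2)
      refine ⟨r • sample x p, ?_, ?_⟩
      · simp only [hN, hj, if_false]
        exact Finset.mem_image_of_mem _ hp
      · have h1 : sample x (ι u) - r • sample x p = r • sample x (ι (r⁻¹ • u) - p) := by
          rw [map_sub, map_smul, map_smul, smul_sub, smul_smul, mul_inv_cancel₀ hr.ne', one_smul]
        rw [h1, norm_smul, Real.norm_of_nonneg hr.le]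
        calc r * ‖sample x (ι (r⁻¹ • u) - p)‖ ≤ r * (Real.sqrt n * ε j) := by
              gcongr
              exact (norm_sample_le x _).trans (by gcongr)
          _ = Real.sqrt n * D0 * (1 / 2) ^ j := by
              rw [hε]
              field_simp
  · intro j
    by_cases hj : j = 0
    · simp only [hN, hj, if_true, Finset.card_singleton, Nat.cast_one]
      exact Real.one_le_exp (by positivity)
    · simp only [hN, hj, if_false]
      calc (((C j).image fun p => r • sample x p).card : ℝ) ≤ (C j).card := by
            exact_mod_cast Finset.card_image_le
        _ ≤ Real.exp (A * ε j ^ (-γ)) := hCcard j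
        _ ≤ Real.exp (A' * (κ * b ^ j) ^ 2) := by
            rw [hεγ]
            gcongr
            exact le_max_left _ _
  · intro j
    -- Bernoulli's inequality: the geometric growth of the entropies absorbs the linear reserve.
    have hbern : δ * (j + 2) ≤ (b ^ j) ^ 2 := by
      have h1 : 1 + (j : ℝ) * (b ^ 2 - 1) ≤ (1 + (b ^ 2 - 1)) ^ j :=
        one_add_mul_le_pow (by nlinarith) j
      have h2 : (1 + (b ^ 2 - 1)) ^ j = (b ^ j) ^ 2 := by
        rw [add_sub_cancel, ← pow_mul, ← pow_mul, mul_comm]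
      have h3 : δ ≤ 1 / 2 := min_le_left _ _
      have h4 : δ * j ≤ (b ^ 2 - 1) * j := by
        gcongr
        exact min_le_right _ _
      linarith
    have hκb : κ0 * (δ * (j + 2)) ≤ (κ * b ^ j) ^ 2 := by
      rw [mul_pow]
      exact mul_le_mul hκκ0 hbern (by positivity) (by positivity)
    have h5 : (j : ℝ) + 2 ≤ (κ * b ^ j) ^ 2 / (κ0 * δ) := by
      rw [le_div_iff₀ (by positivity)]
      linarith
    have ht2 : 1 ≤ t ^ 2 := one_le_pow₀ ht
    have hb4 : b ^ 2 ≤ 4 := by nlinarith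
    set Z : ℝ := (κ * b ^ j) ^ 2 with hZ
    have hZ0 : 0 ≤ Z := by positivity
    have h6 : (κ * b ^ (j + 1)) ^ 2 = b ^ 2 * Z := by rw [hZ, pow_succ]; ring
    have h7 : (t * s1 * (κ * b ^ j)) ^ 2 / 2 = t ^ 2 * (5 * (A' * Z)) + t ^ 2 * (Z / (κ0 * δ)) := by
      rw [mul_pow, mul_pow, hs1sq, ← hZ]
      ring
    simp only [h6, h7]
    have h8 : A' * (b ^ 2 * Z) ≤ 4 * (A' * Z) := by
      have : 0 ≤ A' * Z := by positivity
      nlinarith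
    have h9 : 5 * (A' * Z) ≤ t ^ 2 * (5 * (A' * Z)) :=
      le_mul_of_one_le_left (by positivity) ht2
    have h10 : t ^ 2 * ((j : ℝ) + 2) ≤ t ^ 2 * (Z / (κ0 * δ)) := by gcongr
    linarith
  · intro J
    have hgeom : ∑ j ∈ Finset.range J, (b / 2) ^ j ≤ (1 - b / 2)⁻¹ := by
      rw [← tsum_geometric_of_lt_one (by positivity) (by linarith)]
      exact (summable_geometric_of_lt_one (by positivity) (by linarith)).sum_le_tsum _
        fun j _ => by positivity
    calc ∑ j ∈ Finset.range J, σ * (2 * (Real.sqrt n * D0) * (1 / 2) ^ j) *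
          (t * s1 * (κ * b ^ j))
        = 2 * s1 * t * (σ * Real.sqrt n * (D0 * κ)) * ∑ j ∈ Finset.range J, (b / 2) ^ j := by
          rw [Finset.mul_sum]
          refine Finset.sum_congr rfl fun j _ => ?_
          rw [div_pow, div_pow, one_pow]
          ring
      _ ≤ 2 * s1 * t * (σ * Real.sqrt n * r ^ (γ / 2)) * (1 - b / 2)⁻¹ := by gcongr
      _ = _ := by ring

/-! ### The deterministic energy estimate -/

/-- The energy `‖T v‖_n² + lam ‖v‖²` associated with the regularized problem. -/
noncomputable def regEnergy {d n : ℕ} {Ω : Set (EuclideanSpace ℝ (Fin d))} {X : Type*}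
    [NormedAddCommGroup X] [InnerProductSpace ℝ X] (T : X →L[ℝ] (closure Ω →ᵇ ℝ))
    (x : Fin n → EuclideanSpace ℝ (Fin d)) (lam : ℝ) (v : X) : ℝ :=
  empNorm x (T v) ^ 2 + lam * ‖v‖ ^ 2

section Energy

variable {d n : ℕ} {Ω : Set (EuclideanSpace ℝ (Fin d))} {X : Type*}
  [NormedAddCommGroup X] [InnerProductSpace ℝ X] {T : X →L[ℝ] (closure Ω →ᵇ ℝ)}
  {x : Fin n → EuclideanSpace ℝ (Fin d)} {lam : ℝ}

lemma regEnergy_nonneg (hlam : 0 < lam) (v : X) : 0 ≤ regEnergy T x lam v :=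
  add_nonneg (sq_nonneg _) (by positivity)

lemma empNorm_le_sqrt_regEnergy (hlam : 0 < lam) (v : X) :
    empNorm x (T v) ≤ Real.sqrt (regEnergy T x lam v) :=
  Real.le_sqrt_of_sq_le (le_add_of_nonneg_right (by positivity))

lemma norm_le_sqrt_regEnergy (hlam : 0 < lam) (v : X) :
    lam ^ (1 / 2 : ℝ) * ‖v‖ ≤ Real.sqrt (regEnergy T x lam v) := by
  refine Real.le_sqrt_of_sq_le ?_
  rw [← Real.sqrt_eq_rpow, mul_pow, Real.sq_sqrt hlam.le]
  exact le_add_of_nonneg_left (sq_nonneg _)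

/-- Along the line `f* + c v` the functional is a quadratic polynomial in `c`, minimal at `c = 1`;
comparison with its vertex gives the first-order condition without differentiation. -/
lemma IsRegularizedSolution.regEnergy_le {f fstar : X} {y : Fin n → ℝ} (hlam : 0 < lam)
    (h : IsRegularizedSolution T x (fun i => toFun (T fstar) (x i) + y i) lam f) :
    regEnergy T x lam (f - fstar) ≤
      (∑ i, y i * toFun (T (f - fstar)) (x i)) / n - lam * inner ℝ fstar (f - fstar) := by
  set v := f - fstar with hv
  set E := regEnergy T x lam v with hE
  set p := (∑ i, y i * toFun (T v) (x i)) / n - lam * inner ℝ fstar v with hp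
  have hJ : ∀ c : ℝ, (∑ i, |toFun (T (fstar + c • v)) (x i) -
      (toFun (T fstar) (x i) + y i)| ^ 2) / n + lam * ‖fstar + c • v‖ ^ 2 =
      c ^ 2 * E - 2 * c * p + ((∑ i, y i ^ 2) / n + lam * ‖fstar‖ ^ 2) := by
    intro c
    have h1 : ∑ i, |toFun (T (fstar + c • v)) (x i) - (toFun (T fstar) (x i) + y i)| ^ 2 =
        c ^ 2 * ∑ i, toFun (T v) (x i) ^ 2 - 2 * c * ∑ i, y i * toFun (T v) (x i) +
          ∑ i, y i ^ 2 := by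
      rw [Finset.mul_sum, Finset.mul_sum, ← Finset.sum_sub_distrib, ← Finset.sum_add_distrib]
      refine Finset.sum_congr rfl fun i _ => ?_
      rw [sq_abs, map_add, map_smul, toFun_add, toFun_smul]
      ring
    rw [h1, norm_add_sq_real, norm_smul, inner_smul_right, mul_pow, Real.norm_eq_abs, sq_abs, hE,
      regEnergy, empNorm_sq, hp]
    ring
  have hmin : ∀ c : ℝ, E - 2 * p ≤ c ^ 2 * E - 2 * c * p := by
    intro c
    have h1 := isMinOn_iff.1 h (fstar + c • v) (mem_univ _)
    have h2 := hJ 1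
    rw [one_smul, hv, add_sub_cancel] at h2
    simp only [hJ c, h2] at h1
    linarith
  by_contra hlt
  rw [not_le] at hlt
  have hE0 : 0 ≤ E := regEnergy_nonneg hlam v
  rcases hE0.eq_or_lt with h0 | h0
  · have := hmin 0
    linarith
  · have h1 := hmin (p / E)
    have h2 : (p / E) ^ 2 * E - 2 * (p / E) * p = -(p ^ 2 / E) := by
      field_simp
      ring
    rw [h2] at h1
    have h3 : (E - p) ^ 2 / E = E - 2 * p + p ^ 2 / E := by
      field_simp
      ring
    have h4 : 0 < (E - p) ^ 2 / E := div_pos (pow_pos (by linarith) 2) h0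
    linarith

lemma sqrt_regEnergy_le {f fstar : X} {y : Fin n → ℝ} (hlam : 0 < lam)
    (h : IsRegularizedSolution T x (fun i => toFun (T fstar) (x i) + y i) lam f) {Q : ℝ}
    (hQ0 : 0 ≤ Q) (hQ : ∀ w : X, |∑ i, y i * toFun (T w) (x i)| / n ≤ Q * Real.sqrt (regEnergy T x lam w)) :
    Real.sqrt (regEnergy T x lam (f - fstar)) ≤ Q + lam ^ (1 / 2 : ℝ) * ‖fstar‖ := by
  set v := f - fstar with hv
  set E := Real.sqrt (regEnergy T x lam v) with hE
  have hE0 : 0 ≤ E := Real.sqrt_nonneg _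
  have hEsq : E ^ 2 = regEnergy T x lam v := Real.sq_sqrt (regEnergy_nonneg hlam v)
  have h1 : (∑ i, y i * toFun (T v) (x i)) / n ≤ Q * E :=
    (div_le_div_of_nonneg_right (le_abs_self _) (by positivity)).trans (hQ v)
  have h2 : -(lam * inner ℝ fstar v) ≤ lam ^ (1 / 2 : ℝ) * ‖fstar‖ * E := by
    have h3 : -inner ℝ fstar v ≤ ‖fstar‖ * ‖v‖ :=
      (neg_le_abs _).trans (abs_real_inner_le_norm _ _)
    have h4 : lam = lam ^ (1 / 2 : ℝ) * lam ^ (1 / 2 : ℝ) := by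
      rw [← Real.rpow_add hlam]
      norm_num
    calc -(lam * inner ℝ fstar v) = lam * (-inner ℝ fstar v) := by ring
      _ ≤ lam * (‖fstar‖ * ‖v‖) := by gcongr
      _ = lam ^ (1 / 2 : ℝ) * ‖fstar‖ * (lam ^ (1 / 2 : ℝ) * ‖v‖) := by
          nth_rewrite 1 [h4]
          ring
      _ ≤ _ := by
          gcongr
          exact norm_le_sqrt_regEnergy hlam v
  have h5 := h.regEnergy_le hlam
  rw [← hv, ← hEsq] at h5
  have h6 : E * E ≤ (Q + lam ^ (1 / 2 : ℝ) * ‖fstar‖) * E := by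
    rw [← sq]
    linarith
  rcases hE0.eq_or_lt with h0 | h0
  · rw [← h0]
    positivity
  · exact le_of_mul_le_mul_right h6 h0

end Energy

/-! ### Tail of the energy of the error -/

lemma rho0_pos {X : Type*} [NormedAddCommGroup X] {n : ℕ} {σ : ℝ} (hn : 0 < n) (hσ : 0 < σ)
    (fstar : X) : 0 < rho0 n σ fstar := by
  have : (0 : ℝ) < n := by exact_mod_cast hn
  rw [rho0]
  positivity

lemma norm_le_rho0 {X : Type*} [NormedAddCommGroup X] {n : ℕ} {σ : ℝ} (hσ : 0 < σ)
    (fstar : X) : ‖fstar‖ ≤ rho0 n σ fstar :=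
  le_add_of_nonneg_right (by positivity)

/-- Uniform sub-Gaussian bound for the noise relative to the energy norm. -/
lemma EntropyBound.exists_noise_le_sqrt_regEnergy {d : ℕ} {Ω : Set (EuclideanSpace ℝ (Fin d))}
    {X Y : Type*} [NormedAddCommGroup X] [InnerProductSpace ℝ X]
    [NormedAddCommGroup Y] [InnerProductSpace ℝ Y] {ι : Y →L[ℝ] (closure Ω →ᵇ ℝ)} {γ A : ℝ}
    (h : EntropyBound ι γ A) (hγ : γ < 2) (S : X →L[ℝ] Y) (K : ℝ) :
    ∃ M : ℝ, 0 < M ∧ ∀ (n : ℕ) (x : Fin n → EuclideanSpace ℝ (Fin d)) (σ lam : ℝ) (fstar : X)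
      (𝔛 : Type*) [MeasurableSpace 𝔛] (P : Measure 𝔛) [IsProbabilityMeasure P]
      (e : Fin n → 𝔛 → ℝ) (fn : 𝔛 → X),
      IsInstance P (ι.comp S) γ K x σ lam fstar e fn → ∀ t : ℝ, 1 ≤ t →
        P.real {ω | ¬ ∀ w : X, |∑ i, e i ω * toFun (ι.comp S w) (x i)| / n ≤
          M * t * (lam ^ (1 / 2 : ℝ) * rho0 n σ fstar) *
            Real.sqrt (regEnergy (ι.comp S) x lam w)} ≤ 2 * Real.exp (-t ^ 2) := by
  rcases le_or_gt γ 0 with hγ0 | hγ0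
  · refine ⟨1, one_pos, ?_⟩
    intro n x σ lam fstar 𝔛 _ P _ e fn hI t ht
    have hempty : {ω | ¬ ∀ w : X, |∑ i, e i ω * toFun (ι.comp S w) (x i)| / n ≤
          1 * t * (lam ^ (1 / 2 : ℝ) * rho0 n σ fstar) *
            Real.sqrt (regEnergy (ι.comp S) x lam w)} = ∅ := by
      refine eq_empty_of_forall_notMem fun ω hω => hω fun w => ?_
      have h0 : ∀ i, toFun (ι.comp S w) (x i) = 0 := fun i => by
        have h1 := abs_toFun_le (ι.comp S w) (x i)
        have h2 : ι.comp S w = 0 := h.eq_zero hγ0 (S w)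
        rw [h2, norm_zero] at h1
        rw [h2]
        exact abs_nonpos_iff.1 h1
      have h3 := rho0_pos hI.n_pos hI.sigma_pos fstar
      have h4 := hI.lam_pos
      simp only [h0, mul_zero, Finset.sum_const_zero, abs_zero, zero_div]
      positivity
    rw [hempty, measureReal_empty]
    positivity
  · obtain ⟨M, hM, hbound⟩ := h.exists_noise_bound hγ0 hγ
    set L : ℝ := ‖S‖ + 1 with hL
    have hLpos : 0 < L := by positivity
    refine ⟨M * (max K 1 * L ^ (γ / 2)), by positivity, ?_⟩
    intro n x σ lam fstar 𝔛 _ P _ e fn hI t ht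
    have hlam := hI.lam_pos
    have hσ := hI.sigma_pos
    have hnR : (0 : ℝ) < n := by exact_mod_cast hI.n_pos
    have hρ := rho0_pos hI.n_pos hσ fstar
    set r : ℝ := L * lam ^ (-(1 / 2) : ℝ) with hr
    have hrpos : 0 < r := by positivity
    refine (measureReal_mono ?_).trans (hbound n x σ 𝔛 P e hI.n_pos hσ hI.noise r t hrpos ht)
    intro ω hω hall
    refine hω fun w => ?_
    set E := Real.sqrt (regEnergy (ι.comp S) x lam w) with hE
    have hwE : lam ^ (1 / 2 : ℝ) * ‖w‖ ≤ E := norm_le_sqrt_regEnergy hlam w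
    have heE : empNorm x (ι (S w)) ≤ E := empNorm_le_sqrt_regEnergy (T := ι.comp S) hlam w
    by_cases hw : w = 0
    · have h0 : ∀ i, toFun (ι.comp S w) (x i) = 0 := fun i => by
        have h1 := abs_toFun_le (ι.comp S w) (x i)
        rw [hw, map_zero, norm_zero] at h1
        rw [hw, map_zero]
        exact abs_nonpos_iff.1 h1
      simp only [h0, mul_zero, Finset.sum_const_zero, abs_zero, zero_div]
      positivity
    have hEpos : 0 < E := lt_of_lt_of_le (by positivity) hwE
    have h1 := hall (E⁻¹ • S w) (by
      rw [map_smul, empNorm_smul, abs_of_pos (by positivity), inv_mul_le_iff₀ hEpos, mul_one]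
      exact heE) (by
      rw [norm_smul, norm_inv, Real.norm_of_nonneg hEpos.le, inv_mul_le_iff₀ hEpos]
      have h2 : ‖w‖ ≤ E * lam ^ (-(1 / 2) : ℝ) := by
        rw [Real.rpow_neg hlam.le, ← div_eq_mul_inv, le_div_iff₀ (by positivity), mul_comm]
        exact hwE
      calc ‖S w‖ ≤ ‖S‖ * ‖w‖ := S.le_opNorm w
        _ ≤ L * (E * lam ^ (-(1 / 2) : ℝ)) := by gcongr; linarith
        _ = E * r := by rw [hr]; ring)
    have h3 : ∑ i, e i ω * toFun (ι (E⁻¹ • S w)) (x i) =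
        E⁻¹ * ∑ i, e i ω * toFun (ι.comp S w) (x i) := by
      rw [Finset.mul_sum]
      refine Finset.sum_congr rfl fun i _ => ?_
      rw [map_smul, toFun_smul]
      change _ = E⁻¹ * (e i ω * toFun (ι (S w)) (x i))
      ring
    rw [h3, abs_mul, abs_of_pos (by positivity), inv_mul_le_iff₀ hEpos] at h1
    -- The only use of the parameter choice: the factor `lam^{-γ/4}` from `r^{γ/2}` turns `lam^{1/2
    -- + γ/4}` into `lam^{1/2}`.
    have h4 : σ * Real.sqrt n * r ^ (γ / 2) / n ≤
        max K 1 * L ^ (γ / 2) * (lam ^ (1 / 2 : ℝ) * rho0 n σ fstar) := by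
      have h5 : Real.sqrt n / n = (n : ℝ) ^ (-(1 / 2) : ℝ) := by
        rw [Real.sqrt_div_self', Real.rpow_neg hnR.le, ← Real.sqrt_eq_rpow, one_div]
      have h6 : r ^ (γ / 2) = L ^ (γ / 2) * lam ^ (-(γ / 4)) := by
        rw [hr, Real.mul_rpow hLpos.le (by positivity), ← Real.rpow_mul hlam.le]
        congr 2
        ring
      have h7 : σ * (n : ℝ) ^ (-(1 / 2) : ℝ) ≤
          max K 1 * lam ^ (1 / 2 + γ / 4) * rho0 n σ fstar := by
        have h8 := hI.lam_choice
        rw [← div_eq_mul_inv, div_le_iff₀ hρ] at h8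
        refine h8.trans ?_
        gcongr
        exact le_max_left _ _
      have h9 : lam ^ (1 / 2 + γ / 4) * lam ^ (-(γ / 4)) = lam ^ (1 / 2 : ℝ) := by
        rw [← Real.rpow_add hlam]
        congr 1
        ring
      calc σ * Real.sqrt n * r ^ (γ / 2) / n
          = (σ * (Real.sqrt n / n)) * (L ^ (γ / 2) * lam ^ (-(γ / 4))) := by rw [h6]; ring
        _ ≤ (max K 1 * lam ^ (1 / 2 + γ / 4) * rho0 n σ fstar) *
            (L ^ (γ / 2) * lam ^ (-(γ / 4))) := by
            rw [h5]
            gcongr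
        _ = max K 1 * L ^ (γ / 2) * ((lam ^ (1 / 2 + γ / 4) * lam ^ (-(γ / 4))) *
            rho0 n σ fstar) := by ring
        _ = _ := by rw [h9]
    calc |∑ i, e i ω * toFun (ι.comp S w) (x i)| / n
        ≤ E * (M * t * (σ * Real.sqrt n * r ^ (γ / 2))) / n := by gcongr
      _ = M * t * (σ * Real.sqrt n * r ^ (γ / 2) / n) * E := by ring
      _ ≤ M * t * (max K 1 * L ^ (γ / 2) * (lam ^ (1 / 2 : ℝ) * rho0 n σ fstar)) * E := by
          gcongr
      _ = _ := by ring

/-- Sub-Gaussian tail of the energy norm of the error of the regularized solution. -/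
lemma EntropyBound.exists_regEnergy_tail {d : ℕ} {Ω : Set (EuclideanSpace ℝ (Fin d))}
    {X Y : Type*} [NormedAddCommGroup X] [InnerProductSpace ℝ X]
    [NormedAddCommGroup Y] [InnerProductSpace ℝ Y] {ι : Y →L[ℝ] (closure Ω →ᵇ ℝ)} {γ A : ℝ}
    (h : EntropyBound ι γ A) (hγ : γ < 2) (S : X →L[ℝ] Y) (K : ℝ) :
    ∃ M : ℝ, 1 ≤ M ∧ ∀ (n : ℕ) (x : Fin n → EuclideanSpace ℝ (Fin d)) (σ lam : ℝ) (fstar : X)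
      (𝔛 : Type*) [MeasurableSpace 𝔛] (P : Measure 𝔛) [IsProbabilityMeasure P]
      (e : Fin n → 𝔛 → ℝ) (fn : 𝔛 → X),
      IsInstance P (ι.comp S) γ K x σ lam fstar e fn → ∀ t : ℝ, 1 ≤ t →
        P.real {ω | M * t * (lam ^ (1 / 2 : ℝ) * rho0 n σ fstar) ≤
          Real.sqrt (regEnergy (ι.comp S) x lam (fn ω - fstar))} ≤ 2 * Real.exp (-t ^ 2) := by
  obtain ⟨M, hM, hbound⟩ := h.exists_noise_le_sqrt_regEnergy hγ S K
  -- One unit covers the bias `lam^{1/2} ‖f*‖`; the other makes the contradiction strict at `t = 1`.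
  refine ⟨M + 2, by linarith, ?_⟩
  intro n x σ lam fstar 𝔛 _ P _ e fn hI t ht
  refine (measureReal_mono ?_).trans (hbound n x σ lam fstar 𝔛 P e fn hI t ht)
  intro ω hω hall
  have hlam := hI.lam_pos
  have hρ := rho0_pos hI.n_pos hI.sigma_pos fstar
  have h1 := sqrt_regEnergy_le hlam (hI.minimizer ω) (by positivity) hall
  have h2 : lam ^ (1 / 2 : ℝ) * ‖fstar‖ ≤ lam ^ (1 / 2 : ℝ) * rho0 n σ fstar := by
    gcongr
    exact norm_le_rho0 hI.sigma_pos fstar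
  set R := lam ^ (1 / 2 : ℝ) * rho0 n σ fstar with hR
  have hRpos : 0 < R := by positivity
  have h3 : (M + 2) * t * R ≤ M * t * R + R := hω.trans (h1.trans (by linarith))
  nlinarith [mul_le_mul_of_nonneg_right ht hRpos.le]

/-- Halving the exponent makes the right side at least 1 for `z ≤ M`, where the bound becomes
trivial; this removes the restriction `t ≥ 1`. -/
lemma le_two_mul_exp_of_scaled {F : ℝ → ℝ} {M : ℝ} (hM : 0 < M) (hF1 : ∀ z, F z ≤ 1)
    (hF : ∀ t, 1 ≤ t → F (M * t) ≤ 2 * Real.exp (-t ^ 2)) {z : ℝ} (hz : 0 < z) :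
    F z ≤ 2 * Real.exp (-(1 / (2 * M ^ 2)) * z ^ 2) := by
  have heq : -(1 / (2 * M ^ 2)) * z ^ 2 = -((z / M) ^ 2 / 2) := by
    field_simp
  rw [heq]
  rcases le_total 1 (z / M) with h | h
  · have h1 := hF _ h
    rw [mul_div_cancel₀ _ hM.ne'] at h1
    refine h1.trans ?_
    gcongr
    nlinarith [sq_nonneg (z / M)]
  · refine (hF1 z).trans ?_
    have h1 : (z / M) ^ 2 ≤ 1 := pow_le_one₀ (by positivity) h
    have h2 := Real.add_one_le_exp (-((z / M) ^ 2 / 2))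
    linarith

/-! ### Spectral interpolation and the dual norm -/

section L2

variable {d : ℕ} {Ω : Set (EuclideanSpace ℝ (Fin d))}

lemma continuousOn_toFun (u : closure Ω →ᵇ ℝ) : ContinuousOn (toFun u) (closure Ω) := by
  rw [continuousOn_iff_continuous_domRestrict]
  convert u.continuous using 1
  ext y
  exact toFun_of_mem u y.2

lemma integrable_toFun_mul (hΩ : MeasurableSet Ω) (hb : Bornology.IsBounded Ω)
    (u v : closure Ω →ᵇ ℝ) :
    Integrable (fun y => toFun u y * toFun v y) (volume.restrict Ω) := by
  have : IsFiniteMeasure (volume.restrict Ω) := ⟨by simpa using hb.measure_lt_top⟩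
  refine Integrable.of_bound (C := ‖u‖ * ‖v‖) ?_ (Filter.Eventually.of_forall fun y => ?_)
  · exact (((continuousOn_toFun u).mul (continuousOn_toFun v)).mono
      subset_closure).aestronglyMeasurable hΩ
  · rw [norm_mul]
    exact mul_le_mul (abs_toFun_le u y) (abs_toFun_le v y) (norm_nonneg _) (norm_nonneg _)

lemma l2Inner_comm (u v : closure Ω →ᵇ ℝ) : l2Inner u v = l2Inner v u := by
  simp only [l2Inner, mul_comm]

lemma l2Inner_self_nonneg (u : closure Ω →ᵇ ℝ) : 0 ≤ l2Inner u u :=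
  integral_nonneg fun _ => mul_self_nonneg _

lemma l2Inner_add_left (hΩ : MeasurableSet Ω) (hb : Bornology.IsBounded Ω)
    (u v w : closure Ω →ᵇ ℝ) : l2Inner (u + v) w = l2Inner u w + l2Inner v w := by
  rw [l2Inner, l2Inner, l2Inner, ← integral_add (integrable_toFun_mul hΩ hb u w)
    (integrable_toFun_mul hΩ hb v w)]
  simp only [toFun_add, add_mul]

lemma l2Inner_smul_left (c : ℝ) (u w : closure Ω →ᵇ ℝ) :
    l2Inner (c • u) w = c * l2Inner u w := by
  rw [l2Inner, l2Inner, ← integral_const_mul]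
  simp only [toFun_smul, mul_assoc]

/-- The bilinear form `(u, v) ↦ (u, v)_{L²(Ω)}` on `C(Ω̄)`. -/
noncomputable def l2Form (hΩ : MeasurableSet Ω) (hb : Bornology.IsBounded Ω) :
    (closure Ω →ᵇ ℝ) →ₗ[ℝ] (closure Ω →ᵇ ℝ) →ₗ[ℝ] ℝ :=
  LinearMap.mk₂ ℝ l2Inner (l2Inner_add_left hΩ hb) l2Inner_smul_left
    (fun u v w => by
      rw [l2Inner_comm, l2Inner_add_left hΩ hb, l2Inner_comm v, l2Inner_comm w])
    (fun c u v => by rw [l2Inner_comm, l2Inner_smul_left, l2Inner_comm v]; rfl)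

variable {X : Type*} [NormedAddCommGroup X] [InnerProductSpace ℝ X]
  {T : X →L[ℝ] (closure Ω →ᵇ ℝ)} {φ : HilbertBasis ℕ ℝ X} {η : ℕ → ℝ}

lemma IsEigenbasis.l2Inner_eq (h : IsEigenbasis T φ η) (k : ℕ) (v : X) :
    l2Inner (T (φ k)) (T v) = inner ℝ (φ k) v / η k := by
  rw [h.eigen k v, mul_div_cancel_left₀ _ (h.pos k).ne']

/-- Bessel's inequality in `L²(Ω)` for the orthogonal system `T φ_k`. -/
lemma IsEigenbasis.sum_le_l2Inner (h : IsEigenbasis T φ η) (hΩ : MeasurableSet Ω)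
    (hb : Bornology.IsBounded Ω) (v : X) (s : Finset ℕ) :
    ∑ k ∈ s, inner ℝ (φ k) v ^ 2 / η k ≤ l2Inner (T v) (T v) := by
  classical
  set B := l2Form hΩ hb with hB
  have hBapp : ∀ u w, B u w = l2Inner u w := fun _ _ => rfl
  set w : X := ∑ k ∈ s, (inner ℝ (φ k) v : ℝ) • φ k with hw
  have hTw : ∀ u : X, B (T w) (T u) = ∑ k ∈ s, inner ℝ (φ k) v * (inner ℝ (φ k) u / η k) := by
    intro u
    rw [hw, map_sum, map_sum, LinearMap.sum_apply]
    refine Finset.sum_congr rfl fun k _ => ?_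
    rw [map_smul, map_smul, LinearMap.smul_apply, hBapp, h.l2Inner_eq, smul_eq_mul]
  have h1 : B (T w) (T v) = ∑ k ∈ s, inner ℝ (φ k) v ^ 2 / η k := by
    rw [hTw]
    exact Finset.sum_congr rfl fun k _ => by ring
  have h2 : B (T w) (T w) = ∑ k ∈ s, inner ℝ (φ k) v ^ 2 / η k := by
    rw [hTw]
    refine Finset.sum_congr rfl fun k hk => ?_
    have h3 : inner ℝ (φ k) w = inner ℝ (φ k) v := φ.orthonormal.inner_right_sum _ hk
    rw [h3]
    ring
  have h4 : 0 ≤ B (T v - T w) (T v - T w) := l2Inner_self_nonneg _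
  rw [map_sub, map_sub, LinearMap.sub_apply, LinearMap.sub_apply, h2, h1, hBapp, hBapp,
    l2Inner_comm (T v) (T w), ← hBapp (T w), h1] at h4
  linarith

/-- Two applications of Cauchy–Schwarz: weights `η_k^{∓1/4}` separate `v` from `g`, and then `∑
η_k^{-1/2} v_k²` is split between `∑ v_k² / η_k`, bounded by Bessel in `L²(Ω)`, and `∑ v_k²`.
Partial sums suffice, by passage to the limit. -/
lemma IsEigenbasis.abs_inner_le (h : IsEigenbasis T φ η) (hΩ : MeasurableSet Ω)
    (hb : Bornology.IsBounded Ω) (v : X) {g : X} (hg : MemZ φ η g) :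
    |inner ℝ v g| ≤
      Real.sqrt (Real.sqrt (l2Inner (T v) (T v)) * ‖v‖) * normZ φ η g := by
  have hη : ∀ k, 0 < Real.sqrt (η k) := fun k => Real.sqrt_pos.2 (h.pos k)
  have hfin : ∀ s : Finset ℕ, |∑ k ∈ s, inner ℝ v (φ k) * inner ℝ (φ k) g| ≤
      Real.sqrt (Real.sqrt (l2Inner (T v) (T v)) * ‖v‖) * normZ φ η g := by
    intro s
    rw [normZ, ← Real.sqrt_mul (by positivity)]
    refine Real.abs_le_sqrt ?_
    have h1 : ∑ k ∈ s, inner ℝ v (φ k) * inner ℝ (φ k) g = ∑ k ∈ s,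
        (inner ℝ (φ k) v / Real.sqrt (Real.sqrt (η k))) *
          (Real.sqrt (Real.sqrt (η k)) * inner ℝ (φ k) g) := by
      refine Finset.sum_congr rfl fun k _ => ?_
      have := (Real.sqrt_pos.2 (hη k)).ne'
      rw [real_inner_comm v]
      field_simp
    rw [h1]
    refine (Finset.sum_mul_sq_le_sq_mul_sq _ _ _).trans ?_
    refine mul_le_mul ?_ ?_ (Finset.sum_nonneg fun _ _ => sq_nonneg _) (by positivity)
    · have h2 : ∑ k ∈ s, (inner ℝ (φ k) v / Real.sqrt (Real.sqrt (η k))) ^ 2 =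
          ∑ k ∈ s, (inner ℝ (φ k) v / Real.sqrt (η k)) * inner ℝ (φ k) v := by
        refine Finset.sum_congr rfl fun k _ => ?_
        rw [div_pow, Real.sq_sqrt (hη k).le]
        ring
      rw [h2]
      refine (Real.le_sqrt_of_sq_le (Finset.sum_mul_sq_le_sq_mul_sq _ _ _)).trans ?_
      rw [Real.sqrt_mul (Finset.sum_nonneg fun _ _ => sq_nonneg _)]
      gcongr
      · refine le_trans (le_of_eq ?_) (h.sum_le_l2Inner hΩ hb v s)
        refine Finset.sum_congr rfl fun k _ => ?_
        rw [div_pow, Real.sq_sqrt (h.pos k).le]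
      · refine Real.sqrt_le_iff.2 ⟨norm_nonneg _, ?_⟩
        simpa using φ.orthonormal.sum_inner_products_le v (s := s)
    · have h2 : ∑ k ∈ s, (Real.sqrt (Real.sqrt (η k)) * inner ℝ (φ k) g) ^ 2 =
          ∑ k ∈ s, Real.sqrt (η k) * inner ℝ (φ k) g ^ 2 := by
        refine Finset.sum_congr rfl fun k _ => ?_
        rw [mul_pow, Real.sq_sqrt (hη k).le]
      rw [h2]
      exact hg.sum_le_tsum s fun k _ => by positivity
  exact le_of_tendsto (φ.hasSum_inner_mul_inner v g).abs (Filter.Eventually.of_forall hfin)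

lemma IsEigenbasis.normZDual_sq_le (h : IsEigenbasis T φ η) (hΩ : MeasurableSet Ω)
    (hb : Bornology.IsBounded Ω) (v : X) :
    normZDual φ η v ^ 2 ≤ Real.sqrt (l2Inner (T v) (T v)) * ‖v‖ := by
  have h0 : 0 ≤ normZDual φ η v := by
    refine Real.sSup_nonneg ?_
    rintro t ⟨g, -, -, rfl⟩
    exact div_nonneg (abs_nonneg _) (Real.sqrt_nonneg _)
  refine (Real.le_sqrt h0 (by positivity)).1 (Real.sSup_le ?_ (Real.sqrt_nonneg _))
  rintro t ⟨g, hg, -, rfl⟩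
  exact div_le_of_le_mul₀ (Real.sqrt_nonneg _) (Real.sqrt_nonneg _) (h.abs_inner_le hΩ hb v hg)

end L2

/-- The error in `Z'` is controlled by the energy norm. -/
lemma IsEigenbasis.normZDual_le_regEnergy {d n : ℕ} {Ω : Set (EuclideanSpace ℝ (Fin d))}
    {X Y : Type*} [NormedAddCommGroup X] [InnerProductSpace ℝ X]
    [NormedAddCommGroup Y] [InnerProductSpace ℝ Y] {ι : Y →L[ℝ] (closure Ω →ᵇ ℝ)}
    {S : X →L[ℝ] Y} {φ : HilbertBasis ℕ ℝ X} {η : ℕ → ℝ} (h : IsEigenbasis (ι.comp S) φ η)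
    (hΩ : MeasurableSet Ω) (hb : Bornology.IsBounded Ω) {α β B c lam : ℝ}
    {x : Fin n → EuclideanSpace ℝ (Fin d)} (hS : SamplingSpectralAssumption ι x η α β B c)
    (hlam : 0 < lam) (hn : (n : ℝ) ^ (-β) ≤ lam) (v : X) :
    lam ^ (1 / 2 : ℝ) * normZDual φ η v ^ 2 ≤
      Real.sqrt (max B 0 * (1 + ‖S‖ ^ 2)) * regEnergy (ι.comp S) x lam v := by
  set E := regEnergy (ι.comp S) x lam v with hE
  have hE0 : 0 ≤ E := regEnergy_nonneg hlam v
  have h1 : l2Inner (ι (S v)) (ι (S v)) ≤ max B 0 * (1 + ‖S‖ ^ 2) * E := by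
    -- The condition `n^{-β} ≤ lam` lets the penalty absorb the sampling error.
    have h2 : (n : ℝ) ^ (-β) * ‖S v‖ ^ 2 ≤ ‖S‖ ^ 2 * E := by
      calc (n : ℝ) ^ (-β) * ‖S v‖ ^ 2 ≤ lam * (‖S‖ * ‖v‖) ^ 2 := by
            gcongr
            exact S.le_opNorm v
        _ = ‖S‖ ^ 2 * (lam * ‖v‖ ^ 2) := by ring
        _ ≤ ‖S‖ ^ 2 * E := by
            gcongr
            exact le_add_of_nonneg_left (sq_nonneg _)
    have h3 : empNorm x (ι (S v)) ^ 2 ≤ E :=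
      le_add_of_nonneg_right (by positivity)
    calc l2Inner (ι (S v)) (ι (S v))
        ≤ B * (empNorm x (ι (S v)) ^ 2 + (n : ℝ) ^ (-β) * ‖S v‖ ^ 2) := hS.l2_le (S v)
      _ ≤ max B 0 * (empNorm x (ι (S v)) ^ 2 + (n : ℝ) ^ (-β) * ‖S v‖ ^ 2) := by
          gcongr
          exact le_max_left _ _
      _ ≤ max B 0 * (E + ‖S‖ ^ 2 * E) := by gcongr
      _ = _ := by ring
  calc lam ^ (1 / 2 : ℝ) * normZDual φ η v ^ 2
      ≤ lam ^ (1 / 2 : ℝ) * (Real.sqrt (l2Inner (ι (S v)) (ι (S v))) * ‖v‖) := by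
        gcongr
        exact h.normZDual_sq_le hΩ hb v
    _ = Real.sqrt (l2Inner (ι (S v)) (ι (S v))) * (lam ^ (1 / 2 : ℝ) * ‖v‖) := by ring
    _ ≤ Real.sqrt (max B 0 * (1 + ‖S‖ ^ 2) * E) * Real.sqrt E := by
        gcongr
        exact norm_le_sqrt_regEnergy hlam v
    _ = _ := by
        rw [Real.sqrt_mul (by positivity), mul_assoc, Real.mul_self_sqrt hE0]

end InverseSource

/-! ### Conclusion -/

theorem mainTheorem2
    {d : ℕ} {X Y : Type*}
    [NormedAddCommGroup X] [InnerProductSpace ℝ X] [CompleteSpace X]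
    [NormedAddCommGroup Y] [InnerProductSpace ℝ Y] [CompleteSpace Y]
    (Ω : Set (EuclideanSpace ℝ (Fin d)))
    (hΩ_open : IsOpen Ω) (hΩ_conn : IsConnected Ω) (hΩ_bdd : Bornology.IsBounded Ω)
    (ι : Y →L[ℝ] (closure Ω →ᵇ ℝ)) (hι : Function.Injective ι)
    (S : X →L[ℝ] Y)
    (γ A K : ℝ) (hγ : γ < 2) (hentropy : InverseSource.EntropyBound ι γ A) :
    (∃ C : ℝ, 0 < C ∧
      ∀ (n : ℕ) (x : Fin n → EuclideanSpace ℝ (Fin d)) (σ lam : ℝ) (fstar : X)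
        (𝔛 : Type*) [MeasurableSpace 𝔛] (P : Measure 𝔛) [IsProbabilityMeasure P]
        (e : Fin n → 𝔛 → ℝ) (fn : 𝔛 → X),
        InverseSource.IsInstance P (ι.comp S) γ K x σ lam fstar e fn →
        ∀ z : ℝ, 0 < z →
          P.real {ω | lam ^ (1 / 2 : ℝ) * InverseSource.rho0 n σ fstar * z ≤
              InverseSource.empNorm x (ι (S (fn ω)) - ι (S fstar))} ≤
            2 * Real.exp (-C * z ^ 2) ∧
          P.real {ω | InverseSource.rho0 n σ fstar * z ≤ ‖fn ω‖} ≤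
            2 * Real.exp (-C * z ^ 2)) ∧
    (∀ (φ : HilbertBasis ℕ ℝ X) (η : ℕ → ℝ) (α β B c : ℝ),
      InverseSource.IsEigenbasis (ι.comp S) φ η →
      ∃ C : ℝ, 0 < C ∧
      ∀ (n : ℕ) (x : Fin n → EuclideanSpace ℝ (Fin d)) (σ lam : ℝ) (fstar : X)
        (𝔛 : Type*) [MeasurableSpace 𝔛] (P : Measure 𝔛) [IsProbabilityMeasure P]
        (e : Fin n → 𝔛 → ℝ) (fn : 𝔛 → X),
        InverseSource.IsInstance P (ι.comp S) γ K x σ lam fstar e fn →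
        InverseSource.SamplingSpectralAssumption ι x η α β B c →
        (n : ℝ) ^ (-β) ≤ lam →
        ∀ z : ℝ, 0 < z →
          P.real {ω | lam ^ (1 / 4 : ℝ) * InverseSource.rho0 n σ fstar * z ≤
              InverseSource.normZDual φ η (fn ω - fstar)} ≤
            2 * Real.exp (-C * z ^ 2)) := by
  open InverseSource in
  constructor
  · obtain ⟨M, hM, htail⟩ := hentropy.exists_regEnergy_tail hγ S K
    have hM0 : 0 < M := by linarith
    -- The factor 2 in `2 * M` is for the bound on `‖f_n‖`: subtracting `‖f*‖ ≤ ρ₀ ≤ ρ₀ M t` costs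
    -- half of the threshold `2 M t ρ₀`.
    refine ⟨1 / (2 * (2 * M) ^ 2), by positivity, ?_⟩
    intro n x σ lam fstar 𝔛 _ P _ e fn hI z hz
    have hlam := hI.lam_pos
    have hρ := rho0_pos hI.n_pos hI.sigma_pos fstar
    have hlam' : 0 < lam ^ (1 / 2 : ℝ) := by positivity
    refine ⟨?_, ?_⟩
    · refine le_two_mul_exp_of_scaled (F := fun z => P.real {ω | lam ^ (1 / 2 : ℝ) *
        rho0 n σ fstar * z ≤ empNorm x (ι (S (fn ω)) - ι (S fstar))}) (by positivity)
        (fun _ => measureReal_le_one) (fun t ht => ?_) hz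
      refine (measureReal_mono fun ω hω => ?_).trans
        (htail n x σ lam fstar 𝔛 P e fn hI t ht)
      have h1 := empNorm_le_sqrt_regEnergy (T := ι.comp S) (x := x) hlam (fn ω - fstar)
      have h2 : (ι.comp S) (fn ω - fstar) = ι (S (fn ω)) - ι (S fstar) := map_sub (ι.comp S) _ _
      rw [h2] at h1
      refine le_trans ?_ (le_trans hω h1)
      have : 0 < lam ^ (1 / 2 : ℝ) * rho0 n σ fstar * (M * t) := by positivity
      linarith
    · refine le_two_mul_exp_of_scaled (F := fun z => P.real {ω | rho0 n σ fstar * z ≤ ‖fn ω‖})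
        (by positivity) (fun _ => measureReal_le_one) (fun t ht => ?_) hz
      refine (measureReal_mono fun ω hω => ?_).trans
        (htail n x σ lam fstar 𝔛 P e fn hI t ht)
      refine le_trans ?_ (norm_le_sqrt_regEnergy hlam (fn ω - fstar))
      have h1 : ‖fn ω‖ - ‖fstar‖ ≤ ‖fn ω - fstar‖ := norm_sub_norm_le _ _
      have h2 := norm_le_rho0 (n := n) hI.sigma_pos fstar
      have h3 : rho0 n σ fstar * (2 * M * t) ≤ ‖fn ω‖ := hω
      have h4 : 1 ≤ M * t := one_le_mul_of_one_le_of_one_le hM ht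
      have h5 : rho0 n σ fstar * (M * t) ≤ ‖fn ω - fstar‖ := by nlinarith
      calc M * t * (lam ^ (1 / 2 : ℝ) * rho0 n σ fstar)
          = lam ^ (1 / 2 : ℝ) * (rho0 n σ fstar * (M * t)) := by ring
        _ ≤ _ := by gcongr
  · intro φ η α β B c hφ
    obtain ⟨M, hM, htail⟩ := hentropy.exists_regEnergy_tail hγ S K
    -- The added 1 gives `b ≥ 1`, hence `b ≤ b²`, which is what the comparison of squared thresholds
    -- below needs.
    set b : ℝ := Real.sqrt (max B 0 * (1 + ‖S‖ ^ 2)) + 1 with hb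
    have hb1 : 1 ≤ b := le_add_of_nonneg_left (Real.sqrt_nonneg _)
    refine ⟨1 / (2 * (b * M) ^ 2), by positivity, ?_⟩
    intro n x σ lam fstar 𝔛 _ P _ e fn hI hS hn z hz
    have hlam := hI.lam_pos
    have hρ := rho0_pos hI.n_pos hI.sigma_pos fstar
    refine le_two_mul_exp_of_scaled (F := fun z => P.real {ω | lam ^ (1 / 4 : ℝ) *
      rho0 n σ fstar * z ≤ normZDual φ η (fn ω - fstar)}) (by positivity)
      (fun _ => measureReal_le_one) (fun t ht => ?_) hz
    refine (measureReal_mono fun ω hω => ?_).trans (htail n x σ lam fstar 𝔛 P e fn hI t ht)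
    set E := regEnergy (ι.comp S) x lam (fn ω - fstar) with hE
    have hE0 : 0 ≤ E := regEnergy_nonneg hlam _
    have h1 : lam ^ (1 / 2 : ℝ) * normZDual φ η (fn ω - fstar) ^ 2 ≤ b * E := by
      refine (hφ.normZDual_le_regEnergy hΩ_open.measurableSet hΩ_bdd hS hlam hn _).trans ?_
      gcongr
      linarith
    have h2 : (lam ^ (1 / 4 : ℝ) * rho0 n σ fstar * (b * M * t)) ^ 2 ≤
        normZDual φ η (fn ω - fstar) ^ 2 := by
      gcongr
      exact hω
    have h3 : (lam ^ (1 / 4 : ℝ)) ^ 2 = lam ^ (1 / 2 : ℝ) := by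
      rw [← Real.rpow_natCast, ← Real.rpow_mul hlam.le]
      norm_num
    refine Real.le_sqrt_of_sq_le ?_
    refine le_of_mul_le_mul_left ?_ (by positivity : 0 < b)
    calc b * (M * t * (lam ^ (1 / 2 : ℝ) * rho0 n σ fstar)) ^ 2
        ≤ b ^ 2 * (M * t * (lam ^ (1 / 2 : ℝ) * rho0 n σ fstar)) ^ 2 := by
          gcongr
          nlinarith
      _ = lam ^ (1 / 2 : ℝ) * (lam ^ (1 / 4 : ℝ) * rho0 n σ fstar * (b * M * t)) ^ 2 := by
          rw [mul_pow (lam ^ (1 / 4 : ℝ) * rho0 n σ fstar), mul_pow (lam ^ (1 / 4 : ℝ)), h3]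
          ring
      _ ≤ lam ^ (1 / 2 : ℝ) * normZDual φ η (fn ω - fstar) ^ 2 := by gcongr
      _ ≤ b * E := h1
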